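/- Let $(\Omega,\mathcal F_\infty,(\mathcal F_t)_{t\in\mathbb R_+},P)$ be a filtered complete probability space whose filtration is right continuous and such that $\mathcal F_0$ is the $\sigma$-algebra generated by the $P$-null sets of $\mathcal F_\infty$. Stopping times take values in $[0,+\infty]$, and for a stopping time $\tau$ put $\mathcal F_\tau=\{A\in\mathcal F_\infty : A\cap\{\tau\le t\}\in\mathcal F_t\ \forall t\in\mathbb R_+\}$ and $L^\infty(\mathcal F_\tau)=L^\infty(\Omega,\mathcal F_\tau,P)$. Let $\mathcal Q$ be a set of probability measures on $(\Omega,\mathcal F_\infty)$, all equivalent to $P$, which is stable: for every stopping time $\sigma$ and all $Q,R\in\mathcal Q$ the probability measure $A\mapsto E_Q(R(A\mid\mathcal F_\sigma))$ belongs to $\mathcal Q$. Let $\alpha$ be a nonnegative penalty on $\mathcal Q$, i.e. for all stopping times $\sigma\le\tau$ and all $Q\in\mathcal Q$ an $\mathcal F_\sigma$-measurable map $\alpha_{\sigma,\tau}(Q):\Omega\to[0,+\infty]$, such that * ($\alpha$ is local) for all stopping times $\sigma\le\tau$, all $Q,R\in\mathcal Q$ and all $A\in\mathcal F_\sigma$: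 if $1_A E_Q(X\mid\mathcal F_\sigma)=1_A E_R(X\mid\mathcal F_\sigma)$ a.s. for every $X\in L^\infty(\mathcal F_\tau)$, then $1_A\alpha_{\sigma,\tau}(Q)=1_A\alpha_{\sigma,\tau}(R)$ a.s.; * (cocycle condition) for all stopping times $\nu\le\sigma\le\tau$ and all $Q\in\mathcal Q$: $\alpha_{\nu,\tau}(Q)=\alpha_{\nu,\sigma}(Q)+E_Q(\alpha_{\sigma,\tau}(Q)\mid\mathcal F_\nu)$ $Q$-a.s. Assume that $\alpha_{0,\infty}(Q)=0$ a.s. for at least one $Q\in\mathcal Q$. Then the formula $$\Pi_{\sigma,\tau}(X)=\operatorname*{ess\,sup}_{Q\in\mathcal Q}\bigl(E_Q(X\mid\mathcal F_\sigma)-\alpha_{\sigma,\tau}(Q)\bigr),\qquad \sigma\le\tau\ \text{stopping times},\ X\in L^\infty(\mathcal F_\tau),$$ defines a No Free Lunch TCPP (time-consistent dynamic pricing procedure continuous from below). That is: 1. (dynamic pricing procedure) for all stopping times $\sigma\le\tau$, $\Pi_{\sigma,\tau}$ maps $L^\infty(\mathcal F_\tau)$ into $L^\infty(\mathcal F_\sigma)$,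 is monotone and convex, and satisfies $\Pi_{\sigma,\tau}(X+Z)=\Pi_{\sigma,\tau}(X)+Z$ for $X\in L^\infty(\mathcal F_\tau)$, $Z\in L^\infty(\mathcal F_\sigma)$, and $\Pi_{\sigma,\tau}(0)=0$; 2. (time consistency) $\Pi_{\nu,\sigma}(\Pi_{\sigma,\tau}(X))=\Pi_{\nu,\tau}(X)$ for all stopping times $\nu\le\sigma\le\tau$ and all $X\in L^\infty(\mathcal F_\tau)$; 3. (continuity from below) if $\sigma\le\tau$ are stopping times and $X_n$ is an increasing sequence in $L^\infty(\mathcal F_\tau)$ converging a.s. to $X\in L^\infty(\mathcal F_\tau)$, then $\Pi_{\sigma,\tau}(X_n)\to\Pi_{\sigma,\tau}(X)$ a.s.; 4. (No Static Free Lunch) $\overline{\mathcal C}\cap L^\infty_+(\mathcal F_\infty)=\{0\}$, where $\mathcal C=\{\lambda X : \lambda\ge 0,\ X\in L^\infty(\mathcal F_\infty),\ \Pi_{0,\infty}(X)\le 0\}$; 5. (No Multiperiod Free Lunch) $\overline{\mathcal K}\cap L^\infty_+(\mathcal F_\infty)=\{0\}$, where $\mathcal K=\{\lambda X : \lambda\ge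 0,\ X\in\mathcal K_0\}$ and $\mathcal K_0$ is the set of all $X_0+\sum_{i=1}^n(Z_i-Y_i)$ with $n\ge 0$, $X_0,Y_i,Z_i\in L^\infty(\mathcal F_\infty)$, $\Pi_{0,\infty}(X_0)\le 0$, and $\Pi_{\tau_i,\infty}(Z_i)\le-\Pi_{\tau_i,\infty}(-Y_i)$ for some stopping times $0\le\tau_1\le\dots\le\tau_n<\infty$. Here closures are taken in the weak* topology $\sigma(L^\infty(P),L^1(P))$. -/

import Mathlib

open MeasureTheory ProbabilityTheory Filter Topology
open scoped NNReal ENNReal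

noncomputable section

namespace DynamicPricing

variable {Ω : Type*} [mΩ : MeasurableSpace Ω]

/-! ### Stopping times and the associated sigma-algebras

The ambient sigma-algebra `mΩ` plays the role of `𝓕_∞`. -/

/-- Stopping times with values in `[0, +∞]`, ordered pointwise. -/
abbrev StoppingTime (F : Filtration ℝ≥0 mΩ) : Type _ :=
  {τ : Ω → WithTop ℝ≥0 // IsStoppingTime F τ}

/-- The stopping time constantly equal to `0`. -/
def timeZero (F : Filtration ℝ≥0 mΩ) : StoppingTime F :=
  ⟨fun _ => ((0 : ℝ≥0) : WithTop ℝ≥0), isStoppingTime_const F 0⟩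

/-- The stopping time constantly equal to `+∞`. -/
def timeTop (F : Filtration ℝ≥0 mΩ) : StoppingTime F :=
  ⟨fun _ => ⊤, fun i => by simp⟩

/-- `𝓕_τ = {A ∈ 𝓕_∞ | ∀ t, A ∩ {τ ≤ t} ∈ 𝓕_t}`.  The ambient sigma-algebra `𝓕_∞` may be larger
than the one generated by all the `𝓕_t`; when it is not, this is
`MeasureTheory.IsStoppingTime.measurableSpace`, see `sigmaAt_eq`. -/
@[reducible]
def sigmaAt {F : Filtration ℝ≥0 mΩ} (τ : StoppingTime F) : MeasurableSpace Ω where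
  MeasurableSet' A := MeasurableSet[mΩ] A ∧ ∀ t : ℝ≥0, MeasurableSet[F t] (A ∩ {ω | τ.1 ω ≤ t})
  measurableSet_empty := by simp
  measurableSet_compl A hA := by
    refine ⟨hA.1.compl, fun t => ?_⟩
    have h : Aᶜ ∩ {ω | τ.1 ω ≤ t} = {ω | τ.1 ω ≤ t} \ (A ∩ {ω | τ.1 ω ≤ t}) := by
      ext ω
      simp only [Set.mem_inter_iff, Set.mem_compl_iff, Set.mem_sdiff]
      tauto
    rw [h]
    exact (τ.2 t).diff (hA.2 t)
  measurableSet_iUnion A hA := by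
    refine ⟨MeasurableSet.iUnion fun i => (hA i).1, fun t => ?_⟩
    rw [Set.iUnion_inter]
    exact MeasurableSet.iUnion fun i => (hA i).2 t

theorem sigmaAt_eq {F : Filtration ℝ≥0 mΩ} (hF : mΩ = ⨆ t, F t) (τ : StoppingTime F) :
    sigmaAt τ = τ.2.measurableSpace := by
  ext A
  have h : MeasurableSet[mΩ] A ↔ MeasurableSet[⨆ t, F t] A := by
    conv_lhs => rw [hF]
  exact and_congr_left fun _ => h

/-! ### Bounded positions and dynamic pricing procedures -/

/-- `L^∞(𝓕_∞)`. -/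
abbrev LInf (P : Measure Ω) : Type _ := Lp ℝ ∞ P

/-- `L^∞(𝓕_τ)`, as the subspace of the `𝓕_τ`-measurable classes in `L^∞(𝓕_∞)`. -/
abbrev LInfAt (P : Measure Ω) {F : Filtration ℝ≥0 mΩ} (τ : StoppingTime F) :
    Submodule ℝ (LInf P) :=
  lpMeas ℝ ℝ (sigmaAt τ) ∞ P

/-- A dynamic pricing procedure: for all stopping times `σ ≤ τ` a monotone, translation invariant,
convex and normalized map `L^∞(𝓕_τ) → L^∞(𝓕_σ)`.  The values `price σ τ X` for
`X ∉ L^∞(𝓕_τ)`, or when `σ ≤ τ` fails, carry no meaning. -/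
structure PricingProcedure (P : Measure Ω) (F : Filtration ℝ≥0 mΩ) where
  price : StoppingTime F → StoppingTime F → LInf P → LInf P
  mapsTo : ∀ σ τ, σ ≤ τ → ∀ X ∈ LInfAt P τ, price σ τ X ∈ LInfAt P σ
  monotone : ∀ σ τ, σ ≤ τ → ∀ X ∈ LInfAt P τ, ∀ Y ∈ LInfAt P τ,
    X ≤ Y → price σ τ X ≤ price σ τ Y
  translation : ∀ σ τ, σ ≤ τ → ∀ Z ∈ LInfAt P σ, ∀ X ∈ LInfAt P τ,
    price σ τ (X + Z) = price σ τ X + Z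
  convex : ∀ σ τ, σ ≤ τ → ∀ X ∈ LInfAt P τ, ∀ Y ∈ LInfAt P τ, ∀ c : ℝ, 0 ≤ c → c ≤ 1 →
    price σ τ (c • X + (1 - c) • Y) ≤ c • price σ τ X + (1 - c) • price σ τ Y
  normalized : ∀ σ τ, σ ≤ τ → price σ τ 0 = 0

namespace PricingProcedure

variable {P : Measure Ω} {F : Filtration ℝ≥0 mΩ}

/-- Time consistency. -/
def TimeConsistent (Pi : PricingProcedure P F) : Prop :=
  ∀ ν σ τ, ν ≤ σ → σ ≤ τ → ∀ X ∈ LInfAt P τ,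
    Pi.price ν σ (Pi.price σ τ X) = Pi.price ν τ X

/-- Continuity from below, for almost sure convergence. -/
def ContinuousFromBelow (Pi : PricingProcedure P F) : Prop :=
  ∀ σ τ, σ ≤ τ → ∀ (X : ℕ → LInf P) (Y : LInf P),
    (∀ n, X n ∈ LInfAt P τ) → Y ∈ LInfAt P τ → Monotone X →
    (∀ᵐ ω ∂P, Tendsto (fun n => X n ω) atTop (𝓝 (Y ω))) →
    ∀ᵐ ω ∂P, Tendsto (fun n => Pi.price σ τ (X n) ω) atTop (𝓝 (Pi.price σ τ Y ω))

/-- A TCPP: a time-consistent dynamic pricing procedure continuous from below. -/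
def IsTCPP (Pi : PricingProcedure P F) : Prop :=
  Pi.TimeConsistent ∧ Pi.ContinuousFromBelow

end PricingProcedure

/-! ### No Free Lunch -/

/-- The weak* topology `σ(L^∞(P), L^1(P))`. -/
@[reducible]
def weakStarTopology (P : Measure Ω) : TopologicalSpace (LInf P) :=
  TopologicalSpace.induced (fun (X : LInf P) (g : Lp ℝ 1 P) => ∫ ω, X ω * g ω ∂P)
    Pi.topologicalSpace

/-- The weak* closure of `C` contains `0` and no other nonnegative element of `L^∞(P)`. -/
def MeetsPositiveConeTrivially (P : Measure Ω) (C : Set (LInf P)) : Prop :=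
  closure[weakStarTopology P] C ∩ {X | 0 ≤ X} = {0}

namespace PricingProcedure

variable {P : Measure Ω} {F : Filtration ℝ≥0 mΩ}

/-- The cone generated by the positions with nonpositive ask price at time zero. -/
def staticCone (Pi : PricingProcedure P F) : Set (LInf P) :=
  {W | ∃ c : ℝ, 0 ≤ c ∧ ∃ X : LInf P, Pi.price (timeZero F) (timeTop F) X ≤ 0 ∧ W = c • X}

/-- The financial products attainable at zero cost via simple strategies: one gets `X₀` at time
zero at nonpositive cost and then, at finitely many finite stopping times `τ₁ ≤ ⋯ ≤ τₙ`, sells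
`Yᵢ` and buys `Zᵢ` in a self-financing way. -/
def zeroCost (Pi : PricingProcedure P F) : Set (LInf P) :=
  {W | ∃ (X₀ : LInf P) (n : ℕ) (τ : Fin n → StoppingTime F) (Y Z : Fin n → LInf P),
    Pi.price (timeZero F) (timeTop F) X₀ ≤ 0 ∧
    Monotone τ ∧ (∀ i ω, (τ i).1 ω < ⊤) ∧
    (∀ i, Pi.price (τ i) (timeTop F) (Z i) ≤ -Pi.price (τ i) (timeTop F) (-Y i)) ∧
    W = X₀ + ∑ i, (Z i - Y i)}

/-- The cone generated by `zeroCost`. -/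
def multiperiodCone (Pi : PricingProcedure P F) : Set (LInf P) :=
  {W | ∃ c : ℝ, 0 ≤ c ∧ ∃ X ∈ Pi.zeroCost, W = c • X}

/-- No Static Free Lunch. -/
def NoStaticFreeLunch (Pi : PricingProcedure P F) : Prop :=
  MeetsPositiveConeTrivially P Pi.staticCone

/-- No Multiperiod Free Lunch. -/
def NoMultiperiodFreeLunch (Pi : PricingProcedure P F) : Prop :=
  MeetsPositiveConeTrivially P Pi.multiperiodCone

end PricingProcedure

/-! ### Stable sets of measures and penalties -/

/-- A set of probability measures equivalent to `P` is stable if it is closed under pasting at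
stopping times with values in `[0, +∞]`: for `Q` and `R` in the set, the measure
`A ↦ E_Q (R (A | 𝓕_σ))`, with density process that of `Q` up to `σ` and
`Z^Q_σ Z^R_t / Z^R_σ` after `σ`, is in the set. -/
def IsStable (F : Filtration ℝ≥0 mΩ) (𝒬 : Set (Measure Ω)) : Prop :=
  ∀ σ : StoppingTime F, ∀ Q ∈ 𝒬, ∀ R ∈ 𝒬, ∃ S ∈ 𝒬, ∀ A : Set Ω, MeasurableSet A →
    S.real A = ∫ ω, (R[A.indicator (fun _ => (1 : ℝ)) | sigmaAt σ]) ω ∂Q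

/-- A nonnegative penalty, possibly infinite: `α σ τ Q` is a `[0, +∞]`-valued random variable.
Only the values for `σ ≤ τ` and for `Q` in the set of measures at hand matter. -/
abbrev Penalty (F : Filtration ℝ≥0 mΩ) : Type _ :=
  StoppingTime F → StoppingTime F → Measure Ω → Ω → ℝ≥0∞

namespace Penalty

variable {F : Filtration ℝ≥0 mΩ}

/-- `α_{σ,τ}(Q)` is `𝓕_σ`-measurable. -/
def IsAdapted (α : Penalty F) (𝒬 : Set (Measure Ω)) : Prop :=
  ∀ σ τ, σ ≤ τ → ∀ Q ∈ 𝒬, Measurable[sigmaAt σ] (α σ τ Q)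

/-- Locality: if `A ∈ 𝓕_σ` and `1_A E_Q(X | 𝓕_σ) = 1_A E_R(X | 𝓕_σ)` for all `X ∈ L^∞(𝓕_τ)`, then
`1_A α_{σ,τ}(Q) = 1_A α_{σ,τ}(R)`. -/
def IsLocal (α : Penalty F) (P : Measure Ω) (𝒬 : Set (Measure Ω)) : Prop :=
  ∀ σ τ, σ ≤ τ → ∀ Q ∈ 𝒬, ∀ R ∈ 𝒬, ∀ A : Set Ω, MeasurableSet[sigmaAt σ] A →
    (∀ X ∈ LInfAt P τ, ∀ᵐ ω ∂P, ω ∈ A → (Q[X | sigmaAt σ]) ω = (R[X | sigmaAt σ]) ω) →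
    ∀ᵐ ω ∂P, ω ∈ A → α σ τ Q ω = α σ τ R ω

/-- The cocycle condition
`α_{ν,τ}(Q) = α_{ν,σ}(Q) + E_Q(α_{σ,τ}(Q) | 𝓕_ν)`, `Q`-almost surely, for `ν ≤ σ ≤ τ`. -/
def Cocycle (α : Penalty F) (𝒬 : Set (Measure Ω)) : Prop :=
  ∀ ν σ τ, ν ≤ σ → σ ≤ τ → ∀ Q ∈ 𝒬,
    ∀ᵐ ω ∂Q, α ν τ Q ω = α ν σ Q ω + condLExp (sigmaAt ν) Q (α σ τ Q) ω

end Penalty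

/-! ### Essential suprema -/

/-- `g` is the essential supremum of the family `f`: the (almost surely unique) least measurable
function dominating each member of the family almost surely. -/
def IsEssSup {ι : Type*} (P : Measure Ω) (f : ι → Ω → EReal) (g : Ω → EReal) : Prop :=
  AEMeasurable g P ∧ (∀ i, f i ≤ᵐ[P] g) ∧
    ∀ h : Ω → EReal, AEMeasurable h P → (∀ i, f i ≤ᵐ[P] h) → g ≤ᵐ[P] h

/-- `Π_{σ,τ}(X) = esssup_{Q ∈ 𝒬} (E_Q(X | 𝓕_σ) - α_{σ,τ}(Q))` for all `σ ≤ τ` and all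
`X ∈ L^∞(𝓕_τ)`. -/
def PricingProcedure.IsGivenBy {P : Measure Ω} {F : Filtration ℝ≥0 mΩ}
    (Pi : PricingProcedure P F) (𝒬 : Set (Measure Ω)) (α : Penalty F) : Prop :=
  ∀ σ τ, σ ≤ τ → ∀ X ∈ LInfAt P τ,
    IsEssSup P
      (fun (Q : 𝒬) ω => (((Q.1[X | sigmaAt σ]) ω : ℝ) : EReal) - ((α σ τ Q.1 ω : ℝ≥0∞) : EReal))
      (fun ω => ((Pi.price σ τ X ω : ℝ) : EReal))

end DynamicPricing

end

open DynamicPricing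

/-! The penalized expectation E_Q(X | 𝓕_σ) - α_{σ,τ}(Q) is concave neither in a parameter nor
attained. What replaces compactness is pasting. For A in 𝓕_σ, let σ_A be σ on A and +∞ off A.
Pasting Q and R at σ_A gives a measure that behaves like R given 𝓕_σ on A, and equals Q on subsets
of the complement of A; locality carries this over to penalties (`exists_paste`). Taking A to be the
event where R does better shows that the family is directed upwards, through measures that keep a
prescribed restriction to 𝓕_σ.

Time consistency has two halves. That Π_{ν,τ} is at most the composition follows, for each single Q,
from the tower property and the cocycle condition. For the converse, fix Q and choose S_n equal to Q
on 𝓕_σ whose penalized expectations converge to Π_{σ,τ}(X) (`exists_seq_tendsto_price`). Then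
conditional expectations of 𝓕_σ-measurable variables and the penalty α_{ν,σ} are the same for S_n
and Q, the cocycle condition for S_n bounds each term, and dominated convergence concludes.

Since penalties are nonnegative, the cocycle condition makes the Q with α_{0,∞}(Q) = 0 have zero
penalty between all stopping times. This Q bounds prices from below, normalizes them, and excludes
free lunches: E_Q(X) ≤ E_Q(Π_{σ,τ}(X)), so both cones lie in the weak*-closed half-space of
positions with nonpositive Q-expectation. -/

namespace DynamicPricing

/-! ### Essential suprema of arbitrary families -/

/-- A strictly increasing and bounded transformation of the extended reals. -/
noncomputable def boundedGauge (x : EReal) : ℝ≥0∞ :=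
  (ENNReal.orderIsoIicOneBirational (EReal.exp x)).1

theorem boundedGauge_strictMono : StrictMono boundedGauge := fun _ _ h =>
  ENNReal.orderIsoIicOneBirational.strictMono (EReal.exp_strictMono h)

theorem boundedGauge_le_one (x : EReal) : boundedGauge x ≤ 1 :=
  (ENNReal.orderIsoIicOneBirational (EReal.exp x)).2

theorem measurable_boundedGauge : Measurable boundedGauge :=
  boundedGauge_strictMono.monotone.measurable

variable {Ω : Type*} {m m₁ m₂ : MeasurableSpace Ω} [mΩ : MeasurableSpace Ω]

/-- The essential supremum of a nonempty family of measurable functions is attained as the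
supremum of a countable subfamily. -/
theorem exists_seq_isEssSup {ι : Type*} [Nonempty ι] (P : Measure Ω) [IsFiniteMeasure P]
    (f : ι → Ω → EReal) (hf : ∀ i, Measurable (f i)) :
    ∃ s : ℕ → ι, IsEssSup P f (fun ω => ⨆ n, f (s n) ω) := by
  -- The gauge keeps these integrals finite, so that they can be maximized over countable
  -- subfamilies and equality of integrals gives equality almost everywhere.
  let J : (ℕ → ι) → ℝ≥0∞ := fun s => ∫⁻ ω, boundedGauge (⨆ n, f (s n) ω) ∂P
  have hsup : ∀ s : ℕ → ι, Measurable fun ω => ⨆ n, f (s n) ω :=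
    fun s => Measurable.iSup fun n => hf (s n)
  have hJfin : ∀ s, J s ≠ ∞ := fun s => by
    refine ne_top_of_le_ne_top (measure_ne_top P Set.univ) ?_
    calc J s ≤ ∫⁻ _, 1 ∂P := lintegral_mono fun ω => boundedGauge_le_one _
      _ = P Set.univ := by simp
  obtain ⟨u, -, hu, hmem⟩ := exists_seq_tendsto_sSup (Set.range_nonempty J) (OrderTop.bddAbove _)
  choose t ht using hmem
  -- Merging a maximizing sequence of subfamilies into one attains the maximum of `J`.
  let s : ℕ → ι := fun n => t n.unpair.1 n.unpair.2
  have hle : ∀ s', J s' ≤ J s := by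
    intro s'
    have h1 : J s' ≤ sSup (Set.range J) := le_sSup ⟨s', rfl⟩
    refine h1.trans (le_of_tendsto' hu fun k => ?_)
    rw [← ht k]
    refine lintegral_mono fun ω => boundedGauge_strictMono.monotone (iSup_le fun n => ?_)
    have := le_iSup (fun n => f (s n) ω) (Nat.pair k n)
    simpa [s] using this
  refine ⟨s, (hsup s).aemeasurable, fun i => ?_, fun h _ hh => ?_⟩
  -- Adjoining `i` to the maximal subfamily cannot increase `J`, hence changes its supremum only on
  -- a null set.
  · let s' : ℕ → ι := fun n => Nat.casesOn n i s
    have hs' : ∀ ω, (⨆ n, f (s n) ω) ≤ ⨆ n, f (s' n) ω := fun ω =>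
      iSup_le fun n => le_iSup (fun n => f (s' n) ω) (n + 1)
    have hae := ae_eq_of_ae_le_of_lintegral_le
      (ae_of_all P fun ω => boundedGauge_strictMono.monotone (hs' ω)) (hJfin s)
      (measurable_boundedGauge.comp (hsup s')).aemeasurable (hle s')
    filter_upwards [hae] with ω hω
    rw [boundedGauge_strictMono.injective hω]
    exact le_iSup (fun n => f (s' n) ω) 0
  · filter_upwards [ae_all_iff.2 fun n => hh (s n)] with ω hω using iSup_le hω

/-! ### Conditional expectations -/

/-- An upper bound for the conditional expectations of a bounded convergent sequence is an upper
bound for the conditional expectation of its limit. -/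
theorem condExp_coe_le_of_tendsto (hm : m ≤ mΩ) {Q : Measure Ω}
    [IsFiniteMeasure Q] {f : ℕ → Ω → ℝ} {g : Ω → ℝ} {C : ℝ} {h : Ω → EReal}
    (hf : ∀ n, AEStronglyMeasurable (f n) Q) (hC : ∀ n, ∀ᵐ ω ∂Q, ‖f n ω‖ ≤ C)
    (hlim : ∀ᵐ ω ∂Q, Tendsto (fun n => f n ω) atTop (𝓝 (g ω)))
    (hle : ∀ n, ∀ᵐ ω ∂Q, (((Q[f n | m]) ω : ℝ) : EReal) ≤ h ω) :
    ∀ᵐ ω ∂Q, (((Q[g | m]) ω : ℝ) : EReal) ≤ h ω := by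
  -- Convergence in L¹ suffices: the bound survives along an almost surely convergent subsequence.
  have h1 := tendsto_condExpL1_of_dominated_convergence hm (fun _ => C) hf
    (integrable_const C) hC hlim
  obtain ⟨ns, -, hns⟩ := (tendstoInMeasure_of_tendsto_Lp h1).exists_seq_tendsto_ae
  filter_upwards [hns, condExp_ae_eq_condExpL1 hm g (μ := Q), ae_all_iff.2 hle,
    ae_all_iff.2 fun n => condExp_ae_eq_condExpL1 hm (f n) (μ := Q)] with ω h2 h3 h4 h5
  rw [h3]
  refine le_of_tendsto' ((continuous_coe_real_ereal.tendsto _).comp h2) fun n => ?_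
  simpa [← h5] using h4 (ns n)

/-- Conditional expectations of `m₂`-measurable functions depend only on the restriction of the
measure to `m₂`. -/
theorem condExp_congr_of_forall_measure_eq (hm : m₁ ≤ m₂)
    (hm₂ : m₂ ≤ mΩ) {Q S : Measure Ω} [IsFiniteMeasure Q] [IsFiniteMeasure S] (hSQ : S ≪ Q)
    (h : ∀ A, MeasurableSet[m₂] A → S A = Q A) {X : Ω → ℝ}
    (hX : AEStronglyMeasurable[m₂] X Q) (hQ : Integrable X Q) (hS : Integrable X S) :
    S[X | m₁] =ᵐ[S] Q[X | m₁] := by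
  have htrim : S.trim hm₂ = Q.trim hm₂ := by
    refine @Measure.ext _ m₂ _ _ fun A hA => ?_
    rw [trim_measurableSet_eq hm₂ hA, trim_measurableSet_eq hm₂ hA, h A hA]
  have hint : ∀ Y : Ω → ℝ, AEStronglyMeasurable[m₂] Y Q → ∫ ω, Y ω ∂S = ∫ ω, Y ω ∂Q := by
    intro Y hY
    rw [integral_congr_ae hY.ae_eq_mk, integral_congr_ae (hSQ hY.ae_eq_mk),
      integral_trim hm₂ hY.stronglyMeasurable_mk, integral_trim hm₂ hY.stronglyMeasurable_mk, htrim]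
  have hset : ∀ Y : Ω → ℝ, AEStronglyMeasurable[m₂] Y Q → ∀ s, MeasurableSet[m₁] s →
      ∫ ω in s, Y ω ∂S = ∫ ω in s, Y ω ∂Q := by
    intro Y hY s hs
    rw [← integral_indicator (hm₂ s (hm s hs)), ← integral_indicator (hm₂ s (hm s hs))]
    refine hint _ ⟨s.indicator (hY.mk Y), hY.stronglyMeasurable_mk.indicator (hm s hs), ?_⟩
    filter_upwards [hY.ae_eq_mk] with ω hω
    simp only [Set.indicator, hω]
  have hce : StronglyMeasurable[m₂] (Q[X | m₁]) := stronglyMeasurable_condExp.mono hm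
  have hceS : Integrable (Q[X | m₁]) S := by
    refine integrable_of_integrable_trim hm₂ ?_
    rw [htrim]
    exact integrable_condExp.trim hm₂ hce
  refine (ae_eq_condExp_of_forall_setIntegral_eq (hm.trans hm₂) hS
    (fun s _ _ => hceS.integrableOn) (fun s hs _ => ?_)
    stronglyMeasurable_condExp.aestronglyMeasurable).symm
  rw [hset _ hce.aestronglyMeasurable s hs, setIntegral_condExp (hm.trans hm₂) hQ hs,
    hset X hX s hs]

/-! ### Pasting of measures -/

section Pasting

variable {Q R S : Measure Ω} [IsProbabilityMeasure Q]
  [IsProbabilityMeasure R] [IsProbabilityMeasure S]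

theorem pasting_measure_eq (hm : m ≤ mΩ)
    (hS : ∀ A : Set Ω, MeasurableSet A →
      S.real A = ∫ ω, (R[A.indicator (fun _ => (1 : ℝ)) | m]) ω ∂Q)
    {A : Set Ω} (hA : MeasurableSet[m] A) : S A = Q A := by
  have h := hS A (hm A hA)
  rw [condExp_of_stronglyMeasurable hm (stronglyMeasurable_const.indicator hA)
    ((integrable_const _).indicator (hm A hA)), integral_indicator_const _ (hm A hA)] at h
  simpa [measureReal_def, ENNReal.toReal_eq_toReal_iff'] using h

/-- Conditional expectation under R is self-adjoint, so E_Q(E_R(Y | m)) = E_R(D Y) with D =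
E_R(dQ/dR | m). On indicators this says that S has density D with respect to R, and the same
identity then gives the formula for every bounded X. -/
theorem pasting_integral_eq (hm : m ≤ mΩ) (hQR : Q ≪ R)
    (hS : ∀ A : Set Ω, MeasurableSet A →
      S.real A = ∫ ω, (R[A.indicator (fun _ => (1 : ℝ)) | m]) ω ∂Q)
    {X : Ω → ℝ} {C : ℝ} (hX : AEStronglyMeasurable X R) (hC : ∀ᵐ ω ∂ R, |X ω| ≤ C) :
    ∫ ω, X ω ∂S = ∫ ω, (R[X | m]) ω ∂Q := by
  set r : Ω → ℝ := fun ω => (Q.rnDeriv R ω).toReal with hr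
  have hrint : Integrable r R := Measure.integrable_toReal_rnDeriv
  set D : Ω → ℝ := R[r | m] with hD
  have hDm : StronglyMeasurable[m] D := stronglyMeasurable_condExp
  have hDint : Integrable D R := integrable_condExp
  have hD0 : 0 ≤ᵐ[R] D := condExp_nonneg (ae_of_all _ fun ω => ENNReal.toReal_nonneg)
  have key : ∀ (Y : Ω → ℝ) (c : ℝ), AEStronglyMeasurable Y R → (∀ᵐ ω ∂ R, |Y ω| ≤ c) →
      ∫ ω, (R[Y | m]) ω ∂Q = ∫ ω, D ω * Y ω ∂ R := by
    intro Y c hY hc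
    have hYint : Integrable Y R := .of_bound hY c hc
    have hcY : ∀ᵐ ω ∂ R, |(R[Y | m]) ω| ≤ c := ae_bdd_abs_condExp_of_ae_bdd_abs hc
    have i1 : Integrable (R[Y | m] * r) R :=
      hrint.bdd_mul (integrable_condExp (μ := R) (m := m) (f := Y)).aestronglyMeasurable
        (by simpa using hcY)
    have i2 : Integrable (D * Y) R := hDint.mul_bdd hY (by simpa using hc)
    have e1 := condExp_mul_of_stronglyMeasurable_left
      (stronglyMeasurable_condExp (μ := R) (m := m) (f := Y)) i1 hrint
    have e2 := condExp_mul_of_stronglyMeasurable_left hDm i2 hYint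
    calc ∫ ω, (R[Y | m]) ω ∂Q = ∫ ω, r ω • (R[Y | m]) ω ∂ R := (integral_rnDeriv_smul hQR).symm
      _ = ∫ ω, (R[Y | m] * r) ω ∂ R := by simp [mul_comm]
      _ = ∫ ω, (R[R[Y | m] * r | m]) ω ∂ R := (integral_condExp hm).symm
      _ = ∫ ω, (R[D * Y | m]) ω ∂ R := by
        refine integral_congr_ae ?_
        filter_upwards [e1, e2] with ω h1 h2
        rw [h1, h2, Pi.mul_apply, Pi.mul_apply, mul_comm]
      _ = ∫ ω, (D * Y) ω ∂ R := integral_condExp hm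
      _ = ∫ ω, D ω * Y ω ∂ R := rfl
  have hSD : S = R.withDensity fun ω => ENNReal.ofReal (D ω) := by
    ext A hA
    have h1 : S.real A = ∫ ω in A, D ω ∂ R := by
      rw [hS A hA, key _ 1 ((stronglyMeasurable_const.indicator hA).aestronglyMeasurable)
        (ae_of_all _ fun ω => by by_cases h : ω ∈ A <;> simp [h]), ← integral_indicator hA]
      congr 1 with ω
      by_cases h : ω ∈ A <;> simp [h]
    rw [withDensity_apply _ hA, ← ofReal_integral_eq_lintegral_ofReal hDint.integrableOn
      (ae_restrict_of_ae hD0), ← h1, ofReal_measureReal]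
  rw [key X C hX hC, hSD, integral_withDensity_eq_integral_toReal_smul
    (hDm.mono hm).measurable.ennreal_ofReal (by simp)]
  refine integral_congr_ae ?_
  filter_upwards [hD0] with ω h
  rw [ENNReal.toReal_ofReal h, smul_eq_mul]

/-- Where the pasting `σ`-algebra `m` coincides with `m₁`, the pasted measure has the conditional
expectations of `R` given `m₁`. -/
theorem pasting_condExp_eq (hm₁ : m₁ ≤ m) (hm : m ≤ mΩ) (hQR : Q ≪ R)
    (hSR : S ≪ R)
    (hS : ∀ A : Set Ω, MeasurableSet A →
      S.real A = ∫ ω, (R[A.indicator (fun _ => (1 : ℝ)) | m]) ω ∂Q)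
    {A : Set Ω} (hA : MeasurableSet[m₁] A)
    (hmA : ∀ t, MeasurableSet[m] (A ∩ t) ↔ MeasurableSet[m₁] (A ∩ t))
    {X : Ω → ℝ} {C : ℝ} (hX : AEStronglyMeasurable X R) (hC : ∀ᵐ ω ∂ R, |X ω| ≤ C) :
    ∀ᵐ ω ∂S, ω ∈ A → (S[X | m₁]) ω = (R[X | m₁]) ω := by
  have hm₁Ω := hm₁.trans hm
  have hXS : Integrable X S := .of_bound (hX.mono_ac hSR) C (hSR hC)
  have hXR : Integrable X R := .of_bound hX C hC
  have hcR : ∀ᵐ ω ∂ R, |(R[X | m₁]) ω| ≤ C := ae_bdd_abs_condExp_of_ae_bdd_abs hC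
  have hRm : StronglyMeasurable (R[X | m₁]) := stronglyMeasurable_condExp.mono hm₁Ω
  have hRS : Integrable (R[X | m₁]) S := .of_bound hRm.aestronglyMeasurable C (hSR hcR)
  have hRQ : Integrable (R[X | m₁]) Q := .of_bound hRm.aestronglyMeasurable C (hQR hcR)
  have hAΩ := hm₁Ω A hA
  -- The two σ-algebras have the same trace on `A`.
  have hloc : ∀ᵐ ω ∂ R, ω ∈ A → (R[X | m]) ω = (R[X | m₁]) ω :=
    (ae_restrict_iff' hAΩ).1
      (condExp_ae_eq_restrict_of_measurableSpace_eq_on hm hm₁Ω (hm₁ A hA) hmA)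
  have heq : A.indicator (R[X | m₁]) =ᵐ[S] S[A.indicator X | m₁] := by
    refine ae_eq_condExp_of_forall_setIntegral_eq hm₁Ω (hXS.indicator hAΩ)
      (fun s _ _ => (hRS.indicator hAΩ).integrableOn) (fun s hs _ => ?_)
      (stronglyMeasurable_condExp.indicator hA).aestronglyMeasurable
    have hsA : MeasurableSet[m₁] (s ∩ A) := hs.inter hA
    have hsAΩ := hm₁Ω _ hsA
    rw [setIntegral_indicator hAΩ, setIntegral_indicator hAΩ]
    have hXs : ∀ᵐ ω ∂ R, |(s ∩ A).indicator X ω| ≤ C := by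
      filter_upwards [hC] with ω h
      by_cases hω : ω ∈ s ∩ A
      · simpa [hω] using h
      · simpa [hω] using (abs_nonneg _).trans h
    have hRs : ∀ᵐ ω ∂ R, |(s ∩ A).indicator (R[X | m₁]) ω| ≤ C := by
      filter_upwards [hcR] with ω h
      by_cases hω : ω ∈ s ∩ A
      · simpa [hω] using h
      · simpa [hω] using (abs_nonneg _).trans h
    rw [← integral_indicator hsAΩ, ← integral_indicator hsAΩ,
      pasting_integral_eq hm hQR hS (hX.indicator hsAΩ) hXs,
      pasting_integral_eq hm hQR hS (hRm.aestronglyMeasurable.indicator hsAΩ) hRs]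
    refine integral_congr_ae (hQR ?_)
    rw [condExp_of_stronglyMeasurable hm
      ((stronglyMeasurable_condExp.mono hm₁).indicator (hm₁ _ hsA))
      (integrable_condExp.indicator hsAΩ)]
    filter_upwards [condExp_indicator hXR (hm₁ _ hsA), hloc] with ω h1 h2
    rw [h1]
    by_cases hω : ω ∈ s ∩ A
    · simp [hω, h2 hω.2]
    · simp only [Set.indicator_of_notMem hω]
  filter_upwards [heq, condExp_indicator hXS hA] with ω h1 h2 hω
  rw [h2] at h1
  simpa [hω] using h1.symm

/-- The pasted measure has the conditional expectations of `Q` on a set `A` all of whose measurable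
subsets belong to `m`. -/
theorem pasting_condExp_eq_left (hm₁ : m₁ ≤ mΩ) (hm : m ≤ mΩ)
    (hS : ∀ A : Set Ω, MeasurableSet A →
      S.real A = ∫ ω, (R[A.indicator (fun _ => (1 : ℝ)) | m]) ω ∂Q)
    {A : Set Ω} (hA : MeasurableSet[m₁] A)
    (hmA : ∀ t, MeasurableSet t → MeasurableSet[m] (t ∩ A))
    {X : Ω → ℝ} (hXQ : Integrable X Q) (hXS : Integrable X S) :
    ∀ᵐ ω ∂S, ω ∈ A → (S[X | m₁]) ω = (Q[X | m₁]) ω := by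
  -- `S` and `Q` agree on `m`, which contains every measurable subset of `A`.
  have hres : S.restrict A = Q.restrict A := by
    ext t ht
    rw [Measure.restrict_apply ht, Measure.restrict_apply ht,
      pasting_measure_eq hm hS (hmA t ht)]
  rw [← ae_restrict_iff' (hm₁ A hA)]
  have h1 := condExp_restrict_ae_eq_restrict hm₁ hA hXS
  have h2 := condExp_restrict_ae_eq_restrict hm₁ hA hXQ
  rw [← hres] at h2
  exact h1.symm.trans h2

end Pasting

end DynamicPricing

namespace DynamicPricing

variable {Ω : Type*} [mΩ : MeasurableSpace Ω]

/-! ### Stopping times -/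

section StoppingTimes

variable {F : Filtration ℝ≥0 mΩ}

theorem sigmaAt_le (τ : StoppingTime F) : sigmaAt τ ≤ mΩ := fun _ hA => hA.1

theorem sigmaAt_mono {σ τ : StoppingTime F} (h : σ ≤ τ) : sigmaAt σ ≤ sigmaAt τ := by
  refine fun A hA => ⟨hA.1, fun t => ?_⟩
  have : A ∩ {ω | τ.1 ω ≤ t} = A ∩ {ω | σ.1 ω ≤ t} ∩ {ω | τ.1 ω ≤ t} := by
    ext ω
    exact ⟨fun hω => ⟨⟨hω.1, (h ω).trans hω.2⟩, hω.2⟩, fun hω => ⟨hω.1.1, hω.2⟩⟩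
  rw [this]
  exact (hA.2 t).inter (τ.2 t)

theorem timeZero_le (τ : StoppingTime F) : timeZero F ≤ τ := fun ω => by simp [timeZero]

theorem le_timeTop (τ : StoppingTime F) : τ ≤ timeTop F := fun ω => by simp [timeTop]

theorem ite_top_le_coe_iff {p : Prop} [Decidable p] {x : WithTop ℝ≥0} {t : ℝ≥0} :
    (if p then x else ⊤) ≤ (t : WithTop ℝ≥0) ↔ p ∧ x ≤ t := by
  by_cases h : p
  · rw [if_pos h, and_iff_right h]
  · rw [if_neg h]
    exact iff_of_false (not_le.2 (WithTop.coe_lt_top t)) fun h' => h h'.1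

open Classical in
/-- The stopping time equal to `σ` on `A` and to `+∞` elsewhere. -/
noncomputable def restrictTime (σ : StoppingTime F) (A : Set Ω) (hA : MeasurableSet[sigmaAt σ] A) :
    StoppingTime F :=
  ⟨fun ω => if ω ∈ A then σ.1 ω else ⊤, fun t => by
    convert! hA.2 t using 1
    ext ω
    exact ite_top_le_coe_iff⟩

variable {σ : StoppingTime F} {A : Set Ω} (hA : MeasurableSet[sigmaAt σ] A)

theorem restrictTime_le_iff {ω : Ω} {t : ℝ≥0} :
    (restrictTime σ A hA).1 ω ≤ t ↔ ω ∈ A ∧ σ.1 ω ≤ t := by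
  classical exact ite_top_le_coe_iff

theorem le_restrictTime : σ ≤ restrictTime σ A hA := fun ω => by
  by_cases h : ω ∈ A <;> simp [restrictTime, h]

theorem measurableSet_inter_restrictTime (t : Set Ω) :
    MeasurableSet[sigmaAt (restrictTime σ A hA)] (A ∩ t) ↔ MeasurableSet[sigmaAt σ] (A ∩ t) := by
  refine and_congr_right fun _ => forall_congr' fun s => ?_
  have : A ∩ t ∩ {ω | (restrictTime σ A hA).1 ω ≤ s} = A ∩ t ∩ {ω | σ.1 ω ≤ s} := by
    ext ω
    exact and_congr_right fun h => (restrictTime_le_iff hA).trans (and_iff_right h.1)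
  rw [this]

/-- Off `A` the restricted time is +∞, so all information is already in its σ-algebra; pasting there
changes nothing. -/
theorem measurableSet_inter_compl_restrictTime {t : Set Ω} (ht : MeasurableSet t) :
    MeasurableSet[sigmaAt (restrictTime σ A hA)] (t ∩ Aᶜ) := by
  refine ⟨ht.inter (sigmaAt_le σ A hA).compl, fun s => ?_⟩
  have : t ∩ Aᶜ ∩ {ω | (restrictTime σ A hA).1 ω ≤ s} = ∅ :=
    Set.eq_empty_of_forall_notMem fun ω h => h.1.2 ((restrictTime_le_iff hA).1 h.2).1
  rw [this]
  exact (F s).measurableSet_empty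

end StoppingTimes

/-! ### Bounded positions -/

theorem LInf.exists_bound {P : Measure Ω} (X : LInf P) : ∃ C : ℝ, 0 ≤ C ∧ ∀ᵐ ω ∂P, |X ω| ≤ C := by
  refine ⟨(eLpNormEssSup X P).toReal, ENNReal.toReal_nonneg, ?_⟩
  have hfin : eLpNormEssSup X P ≠ ∞ := by
    simpa using (Lp.memLp X).2.ne
  filter_upwards [ae_le_eLpNormEssSup (f := X) (μ := P)] with ω h
  simpa using ENNReal.toReal_mono hfin h

theorem LInf.integrable {P Q : Measure Ω} [IsFiniteMeasure Q] (h : Q ≪ P) (X : LInf P) :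
    Integrable X Q := by
  obtain ⟨C, -, hC⟩ := X.exists_bound
  exact .of_bound ((Lp.aestronglyMeasurable X).mono_ac h) C (h hC)

/-- Moves comparisons with a possibly infinite penalty into `ℝ≥0∞`, where the cocycle condition
lives. -/
theorem coe_sub_coe_le_iff {a b : ℝ} {c : ℝ≥0∞} :
    (a : EReal) - (c : EReal) ≤ (b : EReal) ↔ ENNReal.ofReal (a - b) ≤ c := by
  induction c with
  | top => simp
  | coe c =>
    have : ((c : ℝ≥0∞) : EReal) = ((c : ℝ) : EReal) := rfl
    rw [this, ← EReal.coe_sub, EReal.coe_le_coe_iff, ENNReal.ofReal_le_iff_le_toReal (by simp)]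
    simp only [ENNReal.coe_toReal]
    constructor <;> intro <;> linarith

theorem coe_le_coe_add_iff {a b : ℝ} {c : ℝ≥0∞} :
    (a : EReal) ≤ (b : EReal) + (c : EReal) ↔ ENNReal.ofReal (a - b) ≤ c := by
  induction c with
  | top => simp
  | coe c =>
    have : ((c : ℝ≥0∞) : EReal) = ((c : ℝ) : EReal) := rfl
    rw [this, ← EReal.coe_add, EReal.coe_le_coe_iff, ENNReal.ofReal_le_iff_le_toReal (by simp)]
    simp only [ENNReal.coe_toReal]
    constructor <;> intro <;> linarith

theorem IsEssSup.ae_eq {ι : Type*} {P : Measure Ω} {f : ι → Ω → EReal} {g g' : Ω → EReal}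
    (h : IsEssSup P f g) (h' : IsEssSup P f g') : g =ᵐ[P] g' :=
  (h.2.2 g' h'.1 h'.2.1).antisymm (h'.2.2 g h.1 h.2.1)

/-! ### Stable sets of measures with a local cocycle penalty -/

/-- `E_Q(X | 𝓕_σ) - α_{σ,τ}(Q)`. -/
noncomputable def penalized {F : Filtration ℝ≥0 mΩ} (α : Penalty F) (σ τ : StoppingTime F)
    (X : Ω → ℝ) (Q : Measure Ω) (ω : Ω) : EReal :=
  (((Q[X | sigmaAt σ]) ω : ℝ) : EReal) - ((α σ τ Q ω : ℝ≥0∞) : EReal)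

/-- A stable set of measures equivalent to `P`, with a local penalty satisfying the cocycle
condition, which vanishes for some measure between the times `0` and `∞`. -/
structure IsStablePenalty (P : Measure Ω) (F : Filtration ℝ≥0 mΩ) (𝒬 : Set (Measure Ω))
    (α : Penalty F) : Prop where
  equiv : ∀ Q ∈ 𝒬, IsProbabilityMeasure Q ∧ Q ≪ P ∧ P ≪ Q
  stable : IsStable F 𝒬
  adapted : α.IsAdapted 𝒬
  isLocal : α.IsLocal P 𝒬
  cocycle : α.Cocycle 𝒬
  zero : ∃ Q ∈ 𝒬, ∀ᵐ ω ∂P, α (timeZero F) (timeTop F) Q ω = 0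

namespace IsStablePenalty

variable {P : Measure Ω} {F : Filtration ℝ≥0 mΩ} {𝒬 : Set (Measure Ω)} {α : Penalty F}
  (H : IsStablePenalty P F 𝒬 α)

include H

/-- In a vanishing sum of nonnegative terms each term vanishes. The cocycle condition at 0 ≤ σ ≤ ∞
gives E_Q(α_{σ,∞}(Q) | 𝓕_0) = 0, hence α_{σ,∞}(Q) = 0; at σ ≤ τ ≤ ∞ it then gives α_{σ,τ}(Q) = 0. -/
theorem exists_forall_eq_zero :
    ∃ Q ∈ 𝒬, ∀ σ τ, σ ≤ τ → ∀ᵐ ω ∂P, α σ τ Q ω = 0 := by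
  obtain ⟨Q, hQ, h0⟩ := H.zero
  obtain ⟨hprob, hQP, hPQ⟩ := H.equiv Q hQ
  have hexp : ∀ σ τ : StoppingTime F, σ ≤ τ → ∀ ν : StoppingTime F,
      (∀ᵐ ω ∂P, condLExp (sigmaAt ν) Q (α σ τ Q) ω = 0) →
      ∀ᵐ ω ∂P, α σ τ Q ω = 0 := by
    intro σ τ hστ ν h
    have hmeas : Measurable (α σ τ Q) := (H.adapted σ τ hστ Q hQ).mono (sigmaAt_le σ) le_rfl
    have : ∫⁻ ω, α σ τ Q ω ∂Q = 0 := by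
      rw [← lintegral_condLExp (sigmaAt_le ν), lintegral_congr_ae (g := fun _ => 0) (hQP h)]
      simp
    exact hPQ ((lintegral_eq_zero_iff hmeas).1 this)
  refine ⟨Q, hQ, fun σ τ hστ => ?_⟩
  have hσ : ∀ᵐ ω ∂P, α σ (timeTop F) Q ω = 0 := by
    refine hexp _ _ (le_timeTop σ) (timeZero F) ?_
    filter_upwards [h0, hPQ (H.cocycle _ _ _ (timeZero_le σ) (le_timeTop σ) Q hQ)] with ω h1 h2
    rw [h1] at h2
    exact (add_eq_zero.1 h2.symm).2
  filter_upwards [hσ, hPQ (H.cocycle _ _ _ hστ (le_timeTop τ) Q hQ)] with ω h1 h2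
  rw [h1] at h2
  exact (add_eq_zero.1 h2.symm).1

theorem measurable_penalized {σ τ : StoppingTime F} (hστ : σ ≤ τ) (X : Ω → ℝ) {Q : Measure Ω}
    (hQ : Q ∈ 𝒬) : Measurable[sigmaAt σ] (penalized α σ τ X Q) := by
  have h1 : Measurable[sigmaAt σ] (Q[X | sigmaAt σ]) := stronglyMeasurable_condExp.measurable
  exact Measurable.sub (measurable_coe_real_ereal.comp h1)
    (measurable_coe_ennreal_ereal.comp (H.adapted σ τ hστ Q hQ))

theorem abs_condExp_le {Q : Measure Ω} (hQ : Q ∈ 𝒬) {σ : StoppingTime F} {X : Ω → ℝ} {C : ℝ}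
    (hC : ∀ᵐ ω ∂P, |X ω| ≤ C) : ∀ᵐ ω ∂P, |(Q[X | sigmaAt σ]) ω| ≤ C := by
  obtain ⟨-, hQP, hPQ⟩ := H.equiv Q hQ
  exact hPQ (ae_bdd_abs_condExp_of_ae_bdd_abs (hQP hC))

/-- Two measures of a stable set can be pasted along an event of `𝓕_σ`. -/
theorem exists_paste {σ τ : StoppingTime F} (hστ : σ ≤ τ) {Q R : Measure Ω} (hQ : Q ∈ 𝒬)
    (hR : R ∈ 𝒬) {A : Set Ω} (hA : MeasurableSet[sigmaAt σ] A) :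
    ∃ S ∈ 𝒬, (∀ B, MeasurableSet[sigmaAt σ] B → S B = Q B) ∧ ∀ X : LInf P,
      (∀ᵐ ω ∂P, ω ∈ A → penalized α σ τ X S ω = penalized α σ τ X R ω) ∧
      (∀ᵐ ω ∂P, ω ∉ A → penalized α σ τ X S ω = penalized α σ τ X Q ω) := by
  -- Switch from `Q` to `R` at `σ` on `A`, and never on the complement.
  obtain ⟨S, hS, hpaste⟩ := H.stable (restrictTime σ A hA) Q hQ R hR
  obtain ⟨hQ1, hQP, hPQ⟩ := H.equiv Q hQ
  obtain ⟨hR1, hRP, hPR⟩ := H.equiv R hR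
  obtain ⟨hS1, hSP, hPS⟩ := H.equiv S hS
  have hle := sigmaAt_mono (le_restrictTime hA)
  have hΩ := sigmaAt_le (restrictTime σ A hA)
  have hin : ∀ X : LInf P, ∀ᵐ ω ∂P, ω ∈ A →
      (S[X | sigmaAt σ]) ω = (R[X | sigmaAt σ]) ω := fun X => by
    obtain ⟨C, -, hC⟩ := X.exists_bound
    exact hPS (pasting_condExp_eq hle hΩ (hQP.trans hPR) (hSP.trans hPR) hpaste hA
      (measurableSet_inter_restrictTime hA) ((Lp.aestronglyMeasurable X).mono_ac hRP) (hRP hC))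
  have hout : ∀ X : LInf P, ∀ᵐ ω ∂P, ω ∈ Aᶜ →
      (S[X | sigmaAt σ]) ω = (Q[X | sigmaAt σ]) ω := fun X =>
    hPS (pasting_condExp_eq_left (sigmaAt_le σ) hΩ hpaste hA.compl
      (fun t ht => measurableSet_inter_compl_restrictTime hA ht) (X.integrable hQP)
      (X.integrable hSP))
  refine ⟨S, hS, fun B hB => pasting_measure_eq hΩ hpaste (hle B hB), fun X => ⟨?_, ?_⟩⟩
  · filter_upwards [hin X, H.isLocal σ τ hστ S hS R hR A hA fun X _ => hin X] with ω h1 h2 hω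
    simp only [penalized, h1 hω, h2 hω]
  · filter_upwards [hout X, H.isLocal σ τ hστ S hS Q hQ Aᶜ hA.compl fun X _ => hout X]
      with ω h1 h2 hω
    simp only [penalized, h1 hω, h2 hω]

/-- Pasting along the event where `R` does strictly better than `Q` realizes the pointwise maximum.
-/
theorem exists_penalized_ge {σ τ : StoppingTime F} (hστ : σ ≤ τ) {Q R : Measure Ω} (hQ : Q ∈ 𝒬)
    (hR : R ∈ 𝒬) (X : LInf P) :
    ∃ S ∈ 𝒬, (∀ B, MeasurableSet[sigmaAt σ] B → S B = Q B) ∧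
      penalized α σ τ X Q ≤ᵐ[P] penalized α σ τ X S ∧
      penalized α σ τ X R ≤ᵐ[P] penalized α σ τ X S := by
  have hA : MeasurableSet[sigmaAt σ] {ω | penalized α σ τ X Q ω < penalized α σ τ X R ω} :=
    @measurableSet_lt _ _ _ _ _ (sigmaAt σ) _ _ _ _ _ (H.measurable_penalized hστ X hQ)
      (H.measurable_penalized hστ X hR)
  obtain ⟨S, hS, hSQ, hpen⟩ := H.exists_paste hστ hQ hR hA
  refine ⟨S, hS, hSQ, ?_, ?_⟩
  · filter_upwards [(hpen X).1, (hpen X).2] with ω h1 h2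
    by_cases hω : penalized α σ τ X Q ω < penalized α σ τ X R ω
    · rw [h1 hω]
      exact hω.le
    · rw [h2 hω]
  · filter_upwards [(hpen X).1, (hpen X).2] with ω h1 h2
    by_cases hω : penalized α σ τ X Q ω < penalized α σ τ X R ω
    · rw [h1 hω]
    · rw [h2 hω]
      exact not_lt.1 hω

theorem exists_forall_penalized_ge {σ τ : StoppingTime F} (hστ : σ ≤ τ) {Q : Measure Ω}
    (hQ : Q ∈ 𝒬) (X : LInf P) {R : ℕ → Measure Ω} (hR : ∀ n, R n ∈ 𝒬) (n : ℕ) :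
    ∃ S ∈ 𝒬, (∀ B, MeasurableSet[sigmaAt σ] B → S B = Q B) ∧
      ∀ k < n, penalized α σ τ X (R k) ≤ᵐ[P] penalized α σ τ X S := by
  induction n with
  | zero => exact ⟨Q, hQ, fun _ _ => rfl, by simp⟩
  | succ n ih =>
    obtain ⟨S, hS, hSQ, hk⟩ := ih
    obtain ⟨S', hS', hSS', h1, h2⟩ := H.exists_penalized_ge hστ hS (hR n) X
    refine ⟨S', hS', fun B hB => (hSS' B hB).trans (hSQ B hB), fun k hkn => ?_⟩
    rcases Nat.lt_succ_iff_lt_or_eq.1 hkn with h | rfl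
    · exact (hk k h).trans h1
    · exact h2

/-- Conditional expectations given the past of `σ` and penalties up to `σ` agree for measures
which agree on `𝓕_σ`. -/
theorem condExp_eq_and_penalty_eq {ν σ : StoppingTime F} (hνσ : ν ≤ σ) {Q S : Measure Ω}
    (hQ : Q ∈ 𝒬) (hS : S ∈ 𝒬) (hSQ : ∀ B, MeasurableSet[sigmaAt σ] B → S B = Q B) :
    (∀ (X : Ω → ℝ) (C : ℝ), AEStronglyMeasurable[sigmaAt σ] X P → (∀ᵐ ω ∂P, |X ω| ≤ C) →
      S[X | sigmaAt ν] =ᵐ[P] Q[X | sigmaAt ν]) ∧ α ν σ S =ᵐ[P] α ν σ Q := by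
  obtain ⟨hQ1, hQP, hPQ⟩ := H.equiv Q hQ
  obtain ⟨hS1, hSP, hPS⟩ := H.equiv S hS
  have key : ∀ (X : Ω → ℝ) (C : ℝ), AEStronglyMeasurable[sigmaAt σ] X P →
      (∀ᵐ ω ∂P, |X ω| ≤ C) → S[X | sigmaAt ν] =ᵐ[P] Q[X | sigmaAt ν] := by
    intro X C hX hC
    have hX' : AEStronglyMeasurable X P := hX.mono (sigmaAt_le σ)
    exact hPS (condExp_congr_of_forall_measure_eq (sigmaAt_mono hνσ) (sigmaAt_le σ)
      (hSP.trans hPQ) hSQ (hX.mono_ac hQP) (.of_bound (hX'.mono_ac hQP) C (hQP hC))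
      (.of_bound (hX'.mono_ac hSP) C (hSP hC)))
  refine ⟨key, ?_⟩
  have := H.isLocal ν σ hνσ S hS Q hQ Set.univ (@MeasurableSet.univ _ (sigmaAt ν)) fun X hX => by
    obtain ⟨C, -, hC⟩ := X.exists_bound
    filter_upwards [key X C (mem_lpMeas_iff_aestronglyMeasurable.1 hX) hC] with ω h _ using h
  filter_upwards [this] with ω h using h trivial

/-! ### The pricing functional -/

/-- A countable supremum is 𝓕_σ-measurable. If |X| ≤ C, it is at most C because penalties are
nonnegative, and at least -C because some measure has zero penalty. -/
theorem exists_isEssSup_penalized [IsProbabilityMeasure P] {σ τ : StoppingTime F} (hστ : σ ≤ τ)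
    (X : LInf P) :
    ∃ Y ∈ LInfAt P σ, IsEssSup P (fun (Q : 𝒬) => penalized α σ τ X Q.1)
      (fun ω => ((Y ω : ℝ) : EReal)) := by
  obtain ⟨Q₀, hQ₀, h0⟩ := H.exists_forall_eq_zero
  have : Nonempty 𝒬 := ⟨⟨Q₀, hQ₀⟩⟩
  obtain ⟨s, hs⟩ := exists_seq_isEssSup P (fun (Q : 𝒬) => penalized α σ τ X Q.1)
    fun Q => (H.measurable_penalized hστ X Q.2).mono (sigmaAt_le σ) le_rfl
  set g : Ω → EReal := fun ω => ⨆ n, penalized α σ τ X (s n).1 ω with hg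
  have hgm : Measurable[sigmaAt σ] g :=
    @Measurable.iSup _ _ _ _ _ (sigmaAt σ) _ _ _ _ _ _ fun n => H.measurable_penalized hστ X (s n).2
  obtain ⟨C, hC0, hC⟩ := X.exists_bound
  have hup : ∀ᵐ ω ∂P, g ω ≤ (C : EReal) := by
    refine hs.2.2 (fun _ => (C : EReal)) aemeasurable_const fun Q => ?_
    filter_upwards [H.abs_condExp_le Q.2 hC (σ := σ)] with ω h
    rw [penalized, coe_sub_coe_le_iff, ENNReal.ofReal_of_nonpos]
    · exact zero_le
    · linarith [(abs_le.1 h).2]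
  have hlow : ∀ᵐ ω ∂P, ((-C : ℝ) : EReal) ≤ g ω := by
    filter_upwards [hs.2.1 ⟨Q₀, hQ₀⟩, H.abs_condExp_le hQ₀ hC (σ := σ), h0 σ τ hστ]
      with ω h1 h2 h3
    refine le_trans ?_ h1
    simp only [penalized, h3, EReal.coe_ennreal_zero, sub_zero, EReal.coe_le_coe_iff]
    exact (abs_le.1 h2).1
  have hcoe : ∀ᵐ ω ∂P, (((g ω).toReal : ℝ) : EReal) = g ω := by
    filter_upwards [hup, hlow] with ω h1 h2
    exact EReal.coe_toReal (h1.trans_lt (EReal.coe_lt_top C)).ne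
      ((EReal.bot_lt_coe (-C)).trans_le h2).ne'
  have hYm : StronglyMeasurable[sigmaAt σ] fun ω => (g ω).toReal :=
    (@Measurable.comp _ _ _ (sigmaAt σ) _ _ _ _ measurable_ereal_toReal hgm).stronglyMeasurable
  have hmem : MemLp (fun ω => (g ω).toReal) ∞ P := by
    refine memLp_top_of_bound (hYm.mono (sigmaAt_le σ)).aestronglyMeasurable C ?_
    filter_upwards [hup, hlow, hcoe] with ω h1 h2 h3
    rw [← h3, EReal.coe_le_coe_iff] at h1 h2
    exact abs_le.2 ⟨h2, h1⟩
  have hYae := hmem.coeFn_toLp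
  have hYg : (fun ω => ((hmem.toLp _ ω : ℝ) : EReal)) =ᵐ[P] g := by
    filter_upwards [hYae, hcoe] with ω h1 h2
    rw [h1, h2]
  refine ⟨hmem.toLp _, ?_, ?_, fun Q => (hs.2.1 Q).trans hYg.symm.le, fun h hh hQ =>
    hYg.le.trans (hs.2.2 h hh hQ)⟩
  · rw [mem_lpMeas_iff_aestronglyMeasurable]
    exact hYm.aestronglyMeasurable.congr hYae.symm
  · exact hs.1.congr hYg.symm

end IsStablePenalty

end DynamicPricing

namespace DynamicPricing

variable {Ω : Type*} [mΩ : MeasurableSpace Ω]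

open Classical in
/-- The essential supremum of `E_Q(X | 𝓕_σ) - α_{σ,τ}(Q)` over `Q ∈ 𝒬`, as an element of
`L^∞(𝓕_σ)`; zero if there is none. -/
noncomputable def essSupPrice (P : Measure Ω) {F : Filtration ℝ≥0 mΩ} (𝒬 : Set (Measure Ω))
    (α : Penalty F) (σ τ : StoppingTime F) (X : LInf P) : LInf P :=
  if h : ∃ Y ∈ LInfAt P σ, IsEssSup P (fun (Q : 𝒬) => penalized α σ τ X Q.1)
      (fun ω => ((Y ω : ℝ) : EReal)) then h.choose else 0

namespace IsStablePenalty

variable {P : Measure Ω} [IsProbabilityMeasure P] {F : Filtration ℝ≥0 mΩ} {𝒬 : Set (Measure Ω)}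
  {α : Penalty F} (H : IsStablePenalty P F 𝒬 α) {ν σ τ : StoppingTime F}

include H

theorem essSupPrice_spec (hστ : σ ≤ τ) (X : LInf P) :
    essSupPrice P 𝒬 α σ τ X ∈ LInfAt P σ ∧
      IsEssSup P (fun (Q : 𝒬) => penalized α σ τ X Q.1)
        (fun ω => ((essSupPrice P 𝒬 α σ τ X ω : ℝ) : EReal)) := by
  have h := H.exists_isEssSup_penalized hστ X
  rw [essSupPrice, dif_pos h]
  exact h.choose_spec

/-- With `price_le`, this characterizes the price as the least h such that the positive part of
E_Q(X | 𝓕_σ) - h is at most α_{σ,τ}(Q) for all Q. -/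
theorem ofReal_condExp_sub_price_le (hστ : σ ≤ τ) (X : LInf P) {Q : Measure Ω} (hQ : Q ∈ 𝒬) :
    ∀ᵐ ω ∂P, ENNReal.ofReal ((Q[X | sigmaAt σ]) ω - essSupPrice P 𝒬 α σ τ X ω) ≤ α σ τ Q ω := by
  filter_upwards [(H.essSupPrice_spec hστ X).2.2.1 ⟨Q, hQ⟩] with ω h
  exact coe_sub_coe_le_iff.1 h

theorem price_le (hστ : σ ≤ τ) (X : LInf P) {h : Ω → ℝ} (hm : AEMeasurable h P)
    (hh : ∀ Q ∈ 𝒬, ∀ᵐ ω ∂P, ENNReal.ofReal ((Q[X | sigmaAt σ]) ω - h ω) ≤ α σ τ Q ω) :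
    ∀ᵐ ω ∂P, essSupPrice P 𝒬 α σ τ X ω ≤ h ω := by
  have := (H.essSupPrice_spec hστ X).2.2.2 (fun ω => ((h ω : ℝ) : EReal))
    (measurable_coe_real_ereal.comp_aemeasurable hm) fun Q => by
      filter_upwards [hh Q.1 Q.2] with ω hω
      exact coe_sub_coe_le_iff.2 hω
  filter_upwards [this] with ω hω using EReal.coe_le_coe_iff.1 hω

theorem exists_forall_condExp_le_price :
    ∃ Q ∈ 𝒬, ∀ σ τ, σ ≤ τ → ∀ X : LInf P,
      ∀ᵐ ω ∂P, (Q[X | sigmaAt σ]) ω ≤ essSupPrice P 𝒬 α σ τ X ω := by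
  obtain ⟨Q, hQ, h0⟩ := H.exists_forall_eq_zero
  refine ⟨Q, hQ, fun σ τ hστ X => ?_⟩
  filter_upwards [H.ofReal_condExp_sub_price_le hστ X hQ, h0 σ τ hστ] with ω h1 h2
  rw [h2, nonpos_iff_eq_zero, ENNReal.ofReal_eq_zero] at h1
  linarith

/-! ### Monotonicity, translation invariance, convexity and normalization -/

theorem price_mono (hστ : σ ≤ τ) {X Y : LInf P} (hXY : X ≤ Y) :
    essSupPrice P 𝒬 α σ τ X ≤ essSupPrice P 𝒬 α σ τ Y := by
  rw [← Lp.coeFn_le]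
  refine H.price_le hστ X (Lp.aestronglyMeasurable _).aemeasurable fun Q hQ => ?_
  obtain ⟨hQ1, hQP, hPQ⟩ := H.equiv Q hQ
  filter_upwards [H.ofReal_condExp_sub_price_le hστ Y hQ,
    hPQ (condExp_mono (X.integrable hQP) (Y.integrable hQP) (hQP ((Lp.coeFn_le X Y).2 hXY)))]
    with ω h1 h2
  exact (ENNReal.ofReal_le_ofReal (by linarith)).trans h1

theorem price_add_le (hστ : σ ≤ τ) (X : LInf P) {Z : LInf P} (hZ : Z ∈ LInfAt P σ) :
    essSupPrice P 𝒬 α σ τ (X + Z) ≤ essSupPrice P 𝒬 α σ τ X + Z := by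
  rw [← Lp.coeFn_le]
  refine H.price_le hστ _ (Lp.aestronglyMeasurable _).aemeasurable fun Q hQ => ?_
  obtain ⟨hQ1, hQP, hPQ⟩ := H.equiv Q hQ
  filter_upwards [H.ofReal_condExp_sub_price_le hστ X hQ,
    hPQ (condExp_congr_ae (m := sigmaAt σ) (hQP (Lp.coeFn_add X Z))),
    hPQ (condExp_add (X.integrable hQP) (Z.integrable hQP) (sigmaAt σ)),
    hPQ (condExp_of_aestronglyMeasurable' (sigmaAt_le σ)
      ((mem_lpMeas_iff_aestronglyMeasurable.1 hZ).mono_ac hQP) (Z.integrable hQP)),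
    Lp.coeFn_add (essSupPrice P 𝒬 α σ τ X) Z] with ω h1 h2 h3 h4 h5
  rw [h2, h3, h5, Pi.add_apply, Pi.add_apply, h4, add_sub_add_right_eq_sub]
  exact h1

theorem price_add (hστ : σ ≤ τ) (X : LInf P) {Z : LInf P} (hZ : Z ∈ LInfAt P σ) :
    essSupPrice P 𝒬 α σ τ (X + Z) = essSupPrice P 𝒬 α σ τ X + Z := by
  refine le_antisymm (H.price_add_le hστ X hZ) ?_
  have := H.price_add_le hστ (X + Z) (neg_mem hZ)
  rw [add_neg_cancel_right, ← sub_eq_add_neg, ← Lp.coeFn_le] at this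
  rw [← Lp.coeFn_le]
  filter_upwards [this, Lp.coeFn_add (essSupPrice P 𝒬 α σ τ X) Z,
    Lp.coeFn_sub (essSupPrice P 𝒬 α σ τ (X + Z)) Z] with ω h1 h2 h3
  rw [h3, Pi.sub_apply] at h1
  rw [h2, Pi.add_apply]
  linarith

theorem price_convex (hστ : σ ≤ τ) (X Y : LInf P) {c : ℝ} (hc0 : 0 ≤ c) (hc1 : c ≤ 1) :
    essSupPrice P 𝒬 α σ τ (c • X + (1 - c) • Y) ≤
      c • essSupPrice P 𝒬 α σ τ X + (1 - c) • essSupPrice P 𝒬 α σ τ Y := by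
  rw [← Lp.coeFn_le]
  refine H.price_le hστ _ (Lp.aestronglyMeasurable _).aemeasurable fun Q hQ => ?_
  obtain ⟨hQ1, hQP, hPQ⟩ := H.equiv Q hQ
  have hcoe : ∀ U V : LInf P, ∀ᵐ ω ∂P, (c • U + (1 - c) • V : LInf P) ω =
      (c • (U : Ω → ℝ) + (1 - c) • (V : Ω → ℝ)) ω := fun U V => by
    filter_upwards [Lp.coeFn_add (c • U) ((1 - c) • V), Lp.coeFn_smul c U,
      Lp.coeFn_smul (1 - c) V] with ω h1 h2 h3
    rw [h1, Pi.add_apply, Pi.add_apply, h2, h3]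
  filter_upwards [H.ofReal_condExp_sub_price_le hστ X hQ, H.ofReal_condExp_sub_price_le hστ Y hQ,
    hPQ (condExp_congr_ae (m := sigmaAt σ) (hQP (hcoe X Y))),
    hPQ (condExp_add ((X.integrable hQP).smul c) ((Y.integrable hQP).smul (1 - c)) (sigmaAt σ)),
    hPQ (condExp_smul c (X : Ω → ℝ) (sigmaAt σ)), hPQ (condExp_smul (1 - c) (Y : Ω → ℝ) (sigmaAt σ)),
    hcoe (essSupPrice P 𝒬 α σ τ X) (essSupPrice P 𝒬 α σ τ Y)] with ω h1 h2 h3 h4 h5 h6 h7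
  by_cases hα : α σ τ Q ω = ∞
  · rw [hα]
    exact le_top
  rw [ENNReal.ofReal_le_iff_le_toReal hα] at h1 h2 ⊢
  rw [h3, h4, h7, Pi.add_apply, h5, h6]
  simp only [Pi.add_apply, Pi.smul_apply, smul_eq_mul]
  have h8 := mul_le_mul_of_nonneg_left h1 hc0
  have h9 := mul_le_mul_of_nonneg_left h2 (sub_nonneg.2 hc1)
  linarith

theorem price_zero (hστ : σ ≤ τ) : essSupPrice P 𝒬 α σ τ 0 = 0 := by
  have hz : ∀ Q ∈ 𝒬, ∀ᵐ ω ∂P, (Q[(0 : LInf P) | sigmaAt σ]) ω = 0 := fun Q hQ => by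
    obtain ⟨hQ1, hQP, hPQ⟩ := H.equiv Q hQ
    filter_upwards [hPQ (condExp_congr_ae (m := sigmaAt σ) (hQP (Lp.coeFn_zero ℝ ∞ P)))] with ω h
    rw [h, condExp_zero, Pi.zero_apply]
  refine le_antisymm ?_ ?_
  · rw [← Lp.coeFn_le]
    refine H.price_le hστ _ (Lp.aestronglyMeasurable _).aemeasurable fun Q hQ => ?_
    filter_upwards [hz Q hQ, Lp.coeFn_zero ℝ ∞ P] with ω h1 h2
    rw [h1, h2]
    simp
  · obtain ⟨Q, hQ, h⟩ := H.exists_forall_condExp_le_price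
    rw [← Lp.coeFn_le]
    filter_upwards [h σ τ hστ 0, hz Q hQ, Lp.coeFn_zero ℝ ∞ P] with ω h1 h2 h3
    rw [h3, Pi.zero_apply, ← h2]
    exact h1

/-! ### Continuity from below -/

/-- Let L be the supremum of the prices of the X_n. For each Q, E_Q(X_n | 𝓕_σ) ≤ L + α_{σ,τ}(Q)
passes to the limit Y, so minimality of the essential supremum bounds the price of Y by L. -/
theorem tendsto_price (hστ : σ ≤ τ) {X : ℕ → LInf P} {Y : LInf P} (hX : Monotone X)
    (hlim : ∀ᵐ ω ∂P, Tendsto (fun n => X n ω) atTop (𝓝 (Y ω))) :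
    ∀ᵐ ω ∂P, Tendsto (fun n => essSupPrice P 𝒬 α σ τ (X n) ω) atTop
      (𝓝 (essSupPrice P 𝒬 α σ τ Y ω)) := by
  have hXmono : ∀ᵐ ω ∂P, Monotone fun n => X n ω := by
    filter_upwards [ae_all_iff.2 fun n => (Lp.coeFn_le _ _).2 (hX (Nat.le_succ n))] with ω h
    exact monotone_nat_of_le_succ h
  have hXY : ∀ n, X n ≤ Y := fun n => by
    rw [← Lp.coeFn_le]
    filter_upwards [hXmono, hlim] with ω h1 h2 using h1.ge_of_tendsto h2 n
  have hmono : ∀ᵐ ω ∂P, Monotone fun n => essSupPrice P 𝒬 α σ τ (X n) ω := by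
    filter_upwards [ae_all_iff.2 fun n =>
      (Lp.coeFn_le _ _).2 (H.price_mono hστ (hX (Nat.le_succ n)))] with ω h
    exact monotone_nat_of_le_succ h
  have hle : ∀ᵐ ω ∂P, ∀ n, essSupPrice P 𝒬 α σ τ (X n) ω ≤ essSupPrice P 𝒬 α σ τ Y ω :=
    ae_all_iff.2 fun n => (Lp.coeFn_le _ _).2 (H.price_mono hστ (hXY n))
  have hbdd : ∀ᵐ ω ∂P, BddAbove (Set.range fun n => essSupPrice P 𝒬 α σ τ (X n) ω) := by
    filter_upwards [hle] with ω h
    exact ⟨_, Set.forall_mem_range.2 h⟩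
  have hY : ∀ᵐ ω ∂P, essSupPrice P 𝒬 α σ τ Y ω ≤ ⨆ n, essSupPrice P 𝒬 α σ τ (X n) ω := by
    refine H.price_le hστ Y
      (AEMeasurable.iSup fun n => (Lp.aestronglyMeasurable _).aemeasurable) fun Q hQ => ?_
    obtain ⟨hQ1, hQP, hPQ⟩ := H.equiv Q hQ
    obtain ⟨C, -, hC⟩ := (X 0).exists_bound
    obtain ⟨D, -, hD⟩ := Y.exists_bound
    -- The sequence lies between its first term and its limit, which dominates it.
    have hb : ∀ n, ∀ᵐ ω ∂P, ‖X n ω‖ ≤ max C D := fun n => by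
      filter_upwards [hC, hD, hXmono, (Lp.coeFn_le _ _).2 (hXY n)] with ω h1 h2 h3 h4
      exact abs_le.2 ⟨by linarith [(abs_le.1 h1).1, h3 (Nat.zero_le n), le_max_left C D],
        by linarith [(abs_le.1 h2).2, le_max_right C D]⟩
    have := condExp_coe_le_of_tendsto (sigmaAt_le σ) (Q := Q)
      (h := fun ω => ((⨆ n, essSupPrice P 𝒬 α σ τ (X n) ω : ℝ) : EReal) + (α σ τ Q ω : EReal))
      (fun n => (Lp.aestronglyMeasurable (X n)).mono_ac hQP) (fun n => hQP (hb n)) (hQP hlim)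
      (fun n => hQP (by
        filter_upwards [H.ofReal_condExp_sub_price_le hστ (X n) hQ, hbdd] with ω h1 h2
        refine coe_le_coe_add_iff.2 ((ENNReal.ofReal_le_ofReal ?_).trans h1)
        have := le_ciSup h2 n
        linarith))
    filter_upwards [hPQ this] with ω h using coe_le_coe_add_iff.1 h
  filter_upwards [hmono, hle, hbdd, hY] with ω h1 h2 h3 h4
  rw [le_antisymm h4 (ciSup_le h2)]
  exact tendsto_atTop_ciSup h1 h3

/-! ### Time consistency -/

/-- No pasting is needed. With Y the price at σ, the positive part of E_Q(X | 𝓕_σ) - Y is at most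
α_{σ,τ}(Q). Conditioning on 𝓕_ν and adding the bound of E_Q(Y | 𝓕_ν) minus the price of Y by
α_{ν,σ}(Q), the penalties sum to α_{ν,τ}(Q). -/
theorem price_le_price_price (hνσ : ν ≤ σ) (hστ : σ ≤ τ) (X : LInf P) :
    essSupPrice P 𝒬 α ν τ X ≤ essSupPrice P 𝒬 α ν σ (essSupPrice P 𝒬 α σ τ X) := by
  rw [← Lp.coeFn_le]
  set Y := essSupPrice P 𝒬 α σ τ X with hY
  refine H.price_le (hνσ.trans hστ) X (Lp.aestronglyMeasurable _).aemeasurable fun Q hQ => ?_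
  obtain ⟨hQ1, hQP, hPQ⟩ := H.equiv Q hQ
  set u : Ω → ℝ := Q[X | sigmaAt σ] - Y with hu
  have huint : Integrable u Q := integrable_condExp.sub (Y.integrable hQP)
  have hpos : Q⁻[fun ω => ENNReal.ofReal (max (u ω) 0) | sigmaAt ν] ≤ᵐ[Q]
      Q⁻[α σ τ Q | sigmaAt ν] := by
    refine condLExp_mono (hQP ?_)
    filter_upwards [H.ofReal_condExp_sub_price_le hστ X hQ] with ω h
    rw [ENNReal.ofReal_max, ENNReal.ofReal_zero, max_eq_left zero_le]
    exact h
  filter_upwards [hPQ hpos, hPQ (H.cocycle ν σ τ hνσ hστ Q hQ),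
    H.ofReal_condExp_sub_price_le hνσ Y hQ,
    hPQ (condLExp_ofReal (sigmaAt ν) huint.pos_part (ae_of_all _ fun ω => le_max_right _ _)),
    hPQ (condExp_mono (m := sigmaAt ν) huint huint.pos_part (ae_of_all _ fun ω => le_max_left _ _)),
    hPQ (condExp_sub integrable_condExp (Y.integrable hQP) (sigmaAt ν)),
    hPQ (condExp_condExp_of_le (f := X) (sigmaAt_mono hνσ) (sigmaAt_le σ))]
    with ω h1 h2 h3 h4 h5 h6 h7
  rw [h4] at h1
  rw [h6, Pi.sub_apply, h7] at h5
  rw [h2, add_comm]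
  refine le_trans ?_ (add_le_add h1 h3)
  refine le_trans ?_ ENNReal.ofReal_add_le
  exact ENNReal.ofReal_le_ofReal (by linarith)

/-- The essential supremum defining the price is an almost sure limit of penalized conditional
expectations under measures which agree on `𝓕_σ` with a given one. -/
theorem exists_seq_tendsto_price (hστ : σ ≤ τ) (X : LInf P) {Q : Measure Ω} (hQ : Q ∈ 𝒬) :
    ∃ (S : ℕ → Measure Ω) (C : ℝ), (∀ n, S n ∈ 𝒬) ∧
      (∀ n B, MeasurableSet[sigmaAt σ] B → S n B = Q B) ∧
      (∀ n, ∀ᵐ ω ∂P, α σ τ (S n) ω ≤ ENNReal.ofReal C) ∧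
      ∀ᵐ ω ∂P, Tendsto (fun n => ((S n)[X | sigmaAt σ]) ω - (α σ τ (S n) ω).toReal) atTop
        (𝓝 (essSupPrice P 𝒬 α σ τ X ω)) := by
  obtain ⟨Q₀, hQ₀, h0⟩ := H.exists_forall_eq_zero
  have : Nonempty 𝒬 := ⟨⟨Q₀, hQ₀⟩⟩
  obtain ⟨s, hs⟩ := exists_seq_isEssSup P (fun (Q : 𝒬) => penalized α σ τ X Q.1)
    fun Q => (H.measurable_penalized hστ X Q.2).mono (sigmaAt_le σ) le_rfl
  have hsup := hs.ae_eq (H.essSupPrice_spec hστ X).2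
  -- The zero-penalty measure is put in front so that every `S n` does at least as well as it, which
  -- forces the penalty of `S n` to be at most 2C.
  let R : ℕ → Measure Ω := fun n => Nat.casesOn n Q₀ fun n => (s n).1
  have hR : ∀ n, R n ∈ 𝒬 := fun n => by
    cases n with
    | zero => exact hQ₀
    | succ n => exact (s n).2
  choose S hS hSQ hge using fun n => H.exists_forall_penalized_ge hστ hQ X hR (n + 1)
  obtain ⟨C, hC0, hC⟩ := X.exists_bound
  have hα : ∀ n, ∀ᵐ ω ∂P, α σ τ (S n) ω ≤ ENNReal.ofReal (2 * C) := by
    intro n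
    filter_upwards [hge n 0 n.succ_pos, h0 σ τ hστ, H.abs_condExp_le hQ₀ hC (σ := σ),
      H.abs_condExp_le (hS n) hC (σ := σ)] with ω h1 h2 h3 h4
    have h1' : penalized α σ τ X Q₀ ω ≤ penalized α σ τ X (S n) ω := h1
    simp only [penalized, h2, EReal.coe_ennreal_zero, sub_zero] at h1'
    by_cases htop : α σ τ (S n) ω = ∞
    · rw [htop] at h1'
      simp at h1'
    rw [← ENNReal.ofReal_toReal htop] at h1' ⊢
    rw [EReal.coe_ennreal_ofReal, max_eq_left ENNReal.toReal_nonneg, ← EReal.coe_sub,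
      EReal.coe_le_coe_iff] at h1'
    refine ENNReal.ofReal_le_ofReal ?_
    linarith [(abs_le.1 h3).1, (abs_le.1 h4).2]
  refine ⟨S, 2 * C, hS, hSQ, hα, ?_⟩
  filter_upwards [hsup, ae_all_iff.2 hα, ae_all_iff.2 fun n => ae_all_iff.2 fun k =>
      ae_all_iff.2 fun hk => hge n k hk,
    ae_all_iff.2 fun n => (H.essSupPrice_spec hστ X).2.2.1 ⟨S n, hS n⟩] with ω h1 h2 h3 h4
  have hreal : ∀ n, penalized α σ τ X (S n) ω =
      ((((S n)[X | sigmaAt σ]) ω - (α σ τ (S n) ω).toReal : ℝ) : EReal) := fun n => by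
    have htop : α σ τ (S n) ω ≠ ∞ := ne_top_of_le_ne_top ENNReal.ofReal_ne_top (h2 n)
    rw [penalized, EReal.coe_sub]
    nth_rewrite 1 [← ENNReal.ofReal_toReal htop]
    rw [EReal.coe_ennreal_ofReal, max_eq_left ENNReal.toReal_nonneg]
  rw [← EReal.tendsto_coe]
  simp_rw [← hreal]
  rw [← h1]
  -- The values along `S` need not be monotone, but the n-th one dominates those of `R 0`, ..., `R
  -- n`, where `R (k + 1)` is `s k`, and never exceeds the essential supremum.
  refine tendsto_order.2 ⟨fun a ha => ?_, fun a ha => Eventually.of_forall fun n => ?_⟩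
  · obtain ⟨k, hk⟩ := lt_iSup_iff.1 ha
    filter_upwards [eventually_gt_atTop k] with n hn
    exact hk.trans_le (h3 n (k + 1) (by omega))
  · rw [h1] at ha
    exact (h4 n).trans_lt ha

/-- With f_n the penalized expectation under S_n, E_Q(f_n | 𝓕_ν) = E_{S_n}(X | 𝓕_ν) -
E_{S_n}(α_{σ,τ}(S_n) | 𝓕_ν). By the cocycle condition for S_n and α_{ν,σ}(S_n) = α_{ν,σ}(Q), this is
at most Π_{ν,τ}(X) + α_{ν,σ}(Q), a bound independent of n. -/
theorem price_price_le_price (hνσ : ν ≤ σ) (hστ : σ ≤ τ) (X : LInf P) :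
    essSupPrice P 𝒬 α ν σ (essSupPrice P 𝒬 α σ τ X) ≤ essSupPrice P 𝒬 α ν τ X := by
  rw [← Lp.coeFn_le]
  refine H.price_le hνσ _ (Lp.aestronglyMeasurable _).aemeasurable fun Q hQ => ?_
  obtain ⟨hQ1, hQP, hPQ⟩ := H.equiv Q hQ
  obtain ⟨S, C, hS, hSQ, hα, hlim⟩ := H.exists_seq_tendsto_price hστ X hQ
  obtain ⟨D, hD0, hD⟩ := X.exists_bound
  set f : ℕ → Ω → ℝ := fun n => (S n)[X | sigmaAt σ] - fun ω => (α σ τ (S n) ω).toReal with hf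
  have hαm : ∀ n, StronglyMeasurable[sigmaAt σ] fun ω => (α σ τ (S n) ω).toReal := fun n =>
    (@Measurable.ennreal_toReal _ (sigmaAt σ) _ (H.adapted σ τ hστ _ (hS n))).stronglyMeasurable
  have hfm : ∀ n, StronglyMeasurable[sigmaAt σ] (f n) := fun n =>
    stronglyMeasurable_condExp.sub (hαm n)
  have hαb : ∀ n, ∀ᵐ ω ∂P, ‖(α σ τ (S n) ω).toReal‖ ≤ max C 0 := fun n => by
    filter_upwards [hα n] with ω h
    rw [Real.norm_of_nonneg ENNReal.toReal_nonneg, ← ENNReal.toReal_ofReal']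
    exact ENNReal.toReal_mono ENNReal.ofReal_ne_top h
  have hfb : ∀ n, ∀ᵐ ω ∂P, ‖f n ω‖ ≤ D + max C 0 := fun n => by
    filter_upwards [hαb n, H.abs_condExp_le (hS n) hD (σ := σ)] with ω h1 h2
    exact (norm_sub_le _ _).trans (add_le_add h2 h1)
  have key : ∀ n, ∀ᵐ ω ∂P, (((Q[f n | sigmaAt ν]) ω : ℝ) : EReal) ≤
      ((essSupPrice P 𝒬 α ν τ X ω : ℝ) : EReal) + ((α ν σ Q ω : ℝ≥0∞) : EReal) := by
    intro n
    obtain ⟨hS1, hSP, hPS⟩ := H.equiv _ (hS n)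
    obtain ⟨hce, hαeq⟩ := H.condExp_eq_and_penalty_eq hνσ hQ (hS n) (hSQ n)
    have hαint : Integrable (fun ω => (α σ τ (S n) ω).toReal) (S n) :=
      .of_bound ((hαm n).mono (sigmaAt_le σ)).aestronglyMeasurable _ (hSP (hαb n))
    have hofReal : α σ τ (S n) =ᵐ[S n] fun ω => ENNReal.ofReal (α σ τ (S n) ω).toReal := by
      filter_upwards [hSP (hα n)] with ω h
      rw [ENNReal.ofReal_toReal (ne_top_of_le_ne_top ENNReal.ofReal_ne_top h)]
    filter_upwards [hce (f n) _ (hfm n).aestronglyMeasurable (hfb n), hαeq,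
      hPS (H.cocycle ν σ τ hνσ hστ _ (hS n)),
      H.ofReal_condExp_sub_price_le (hνσ.trans hστ) X (hS n),
      hPS (condLExp_congr_ae (mΩ := sigmaAt ν) hofReal),
      hPS (condLExp_ofReal (sigmaAt ν) hαint (ae_of_all _ fun ω => ENNReal.toReal_nonneg)),
      hPS (condExp_nonneg (m := sigmaAt ν) (μ := S n)
        (f := fun ω => (α σ τ (S n) ω).toReal) (ae_of_all _ fun ω => ENNReal.toReal_nonneg)),
      hPS (condExp_sub integrable_condExp hαint (sigmaAt ν)),
      hPS (condExp_condExp_of_le (f := X) (sigmaAt_mono hνσ) (sigmaAt_le σ))]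
      with ω h1 h2 h3 h4 h5 h6 h7 h8 h9
    rw [coe_le_coe_add_iff]
    by_cases htop : α ν σ Q ω = ∞
    · rw [htop]
      exact le_top
    rw [h3, h2, h5, h6, ENNReal.ofReal_le_iff_le_toReal
      (ENNReal.add_ne_top.2 ⟨htop, ENNReal.ofReal_ne_top⟩),
      ENNReal.toReal_add htop ENNReal.ofReal_ne_top, ENNReal.toReal_ofReal h7] at h4
    rw [ENNReal.ofReal_le_iff_le_toReal htop, ← h1, h8, Pi.sub_apply, h9]
    linarith
  have := condExp_coe_le_of_tendsto (sigmaAt_le ν) (Q := Q) (f := f)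
    (fun n => ((hfm n).mono (sigmaAt_le σ)).aestronglyMeasurable) (fun n => hQP (hfb n))
    (hQP hlim) (fun n => hQP (key n))
  filter_upwards [hPQ this] with ω h using coe_le_coe_add_iff.1 h

/-! ### The pricing procedure and its absence of free lunches -/

/-- The pricing procedure defined by a stable set of measures and a penalty. -/
noncomputable def pricingProcedure : PricingProcedure P F where
  price := essSupPrice P 𝒬 α
  mapsTo _ _ h X _ := (H.essSupPrice_spec h X).1
  monotone _ _ h _ _ _ _ hXY := H.price_mono h hXY
  translation _ _ h _ hZ X _ := H.price_add h X hZ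
  convex _ _ h X _ Y _ _ h0 h1 := H.price_convex h X Y h0 h1
  normalized _ _ h := H.price_zero h

theorem isTCPP : H.pricingProcedure.IsTCPP :=
  ⟨fun _ _ _ h h' X _ => le_antisymm (H.price_price_le_price h h' X) (H.price_le_price_price h h' X),
    fun _ _ h _ _ _ _ hX hlim => H.tendsto_price h hX hlim⟩

theorem exists_forall_integral_le :
    ∃ Q ∈ 𝒬, ∀ σ τ, σ ≤ τ → ∀ X : LInf P,
      ∫ ω, X ω ∂Q ≤ ∫ ω, essSupPrice P 𝒬 α σ τ X ω ∂Q := by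
  obtain ⟨Q, hQ, h⟩ := H.exists_forall_condExp_le_price
  obtain ⟨hQ1, hQP, hPQ⟩ := H.equiv Q hQ
  refine ⟨Q, hQ, fun σ τ hστ X => ?_⟩
  rw [← integral_condExp (sigmaAt_le σ)]
  exact integral_mono_ae integrable_condExp (LInf.integrable hQP _) (hQP (h σ τ hστ X))

end IsStablePenalty

/-- A set of positions with nonpositive expectation under an equivalent measure does not contain a
free lunch. -/
theorem meetsPositiveConeTrivially_of_integral_nonpos {P Q : Measure Ω} [IsFiniteMeasure P]
    [IsFiniteMeasure Q] (hQP : Q ≪ P) (hPQ : P ≪ Q) {C : Set (LInf P)} (h0 : 0 ∈ C)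
    (hC : ∀ X ∈ C, ∫ ω, X ω ∂Q ≤ 0) : MeetsPositiveConeTrivially P C := by
  have hint : Integrable (fun ω => (Q.rnDeriv P ω).toReal) P := Measure.integrable_toReal_rnDeriv
  have hmem := memLp_one_iff_integrable.2 hint
  have hdens : ∀ X : LInf P, ∫ ω, X ω * hmem.toLp _ ω ∂P = ∫ ω, X ω ∂Q := fun X => by
    rw [← integral_rnDeriv_smul hQP]
    refine integral_congr_ae ?_
    filter_upwards [hmem.coeFn_toLp] with ω h
    rw [h, smul_eq_mul, mul_comm]
  -- Expectation under `Q` is the pairing with dQ/dP in L¹(P), hence weak* continuous.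
  have hclosed : IsClosed[weakStarTopology P] {X : LInf P | ∫ ω, X ω ∂Q ≤ 0} := by
    simp_rw [← hdens]
    let := weakStarTopology P
    have h1 : Continuous fun (X : LInf P) (g : Lp ℝ 1 P) => ∫ ω, X ω * g ω ∂P :=
      continuous_induced_dom
    exact isClosed_le ((continuous_apply (hmem.toLp _)).comp h1) continuous_const
  refine Set.Subset.antisymm ?_ ?_
  · rintro X ⟨hX, hX0⟩
    have hXQ : ∫ ω, X ω ∂Q ≤ 0 :=
      @closure_minimal _ (weakStarTopology P) _ _ hC hclosed X hX
    have hXnn : 0 ≤ᵐ[Q] X := by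
      refine hQP ?_
      filter_upwards [(Lp.coeFn_le 0 X).2 hX0, Lp.coeFn_zero ℝ ∞ P] with ω h1 h2
      rwa [h2] at h1
    have := (integral_eq_zero_iff_of_nonneg_ae hXnn (X.integrable hQP)).1
      (le_antisymm hXQ (integral_nonneg_of_ae hXnn))
    exact Lp.ext (EventuallyEq.trans (hPQ this) (Lp.coeFn_zero ℝ ∞ P).symm)
  · rintro X rfl
    exact ⟨@subset_closure _ (weakStarTopology P) _ _ h0, le_refl (0 : LInf P)⟩

namespace IsStablePenalty

variable {P : Measure Ω} [IsProbabilityMeasure P] {F : Filtration ℝ≥0 mΩ} {𝒬 : Set (Measure Ω)}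
  {α : Penalty F} (H : IsStablePenalty P F 𝒬 α)

/-- Under the zero-penalty Q expectations are at most expected prices. For a trade, E_Q(Z) ≤
E_Q(Π(Z)) ≤ -E_Q(Π(-Y)) ≤ E_Q(Y), so each Z - Y has nonpositive expectation. -/
theorem noFreeLunch :
    H.pricingProcedure.NoStaticFreeLunch ∧ H.pricingProcedure.NoMultiperiodFreeLunch := by
  obtain ⟨Q, hQ, hle⟩ := H.exists_forall_integral_le
  obtain ⟨hQ1, hQP, hPQ⟩ := H.equiv Q hQ
  have hmono : ∀ X Y : LInf P, X ≤ Y → ∫ ω, X ω ∂Q ≤ ∫ ω, Y ω ∂Q := fun X Y h =>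
    integral_mono_ae (X.integrable hQP) (Y.integrable hQP) (hQP ((Lp.coeFn_le X Y).2 h))
  have hneg : ∀ X : LInf P, ∫ ω, (-X : LInf P) ω ∂Q = -∫ ω, X ω ∂Q := fun X => by
    rw [← integral_neg]
    exact integral_congr_ae (hQP (Lp.coeFn_neg X))
  have hadd : ∀ X Y : LInf P, ∫ ω, (X + Y : LInf P) ω ∂Q = ∫ ω, X ω ∂Q + ∫ ω, Y ω ∂Q :=
    fun X Y => by
      rw [← integral_add (X.integrable hQP) (Y.integrable hQP)]
      exact integral_congr_ae (hQP (Lp.coeFn_add X Y))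
  have hzero : ∫ ω, (0 : LInf P) ω ∂Q = 0 := by
    rw [integral_congr_ae (hQP (Lp.coeFn_zero ℝ ∞ P))]
    simp
  have hsmul : ∀ (c : ℝ) (X : LInf P), ∫ ω, (c • X : LInf P) ω ∂Q = c * ∫ ω, X ω ∂Q :=
    fun c X => by
      rw [← integral_const_mul]
      exact integral_congr_ae (hQP (Lp.coeFn_smul c X))
  have hsum : ∀ (n : ℕ) (W : Fin n → LInf P), (∀ i, ∫ ω, W i ω ∂Q ≤ 0) →
      ∫ ω, (∑ i, W i : LInf P) ω ∂Q ≤ 0 := by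
    intro n W hW
    refine Finset.sum_induction W (fun X : LInf P => ∫ ω, X ω ∂Q ≤ 0) (fun X Y hX hY => ?_)
      hzero.le fun i _ => hW i
    rw [hadd]
    exact add_nonpos hX hY
  have hstatic : ∀ X : LInf P, essSupPrice P 𝒬 α (timeZero F) (timeTop F) X ≤ 0 →
      ∫ ω, X ω ∂Q ≤ 0 := fun X hX =>
    (hle _ _ (le_timeTop _) X).trans ((hmono _ _ hX).trans hzero.le)
  have hprice0 : essSupPrice P 𝒬 α (timeZero F) (timeTop F) (0 : LInf P) ≤ 0 :=
    (H.price_zero (le_timeTop _)).le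
  constructor
  · refine meetsPositiveConeTrivially_of_integral_nonpos hQP hPQ
      ⟨0, le_rfl, 0, hprice0, (zero_smul ℝ _).symm⟩ ?_
    rintro W ⟨c, hc, X, hX, rfl⟩
    rw [hsmul]
    exact mul_nonpos_of_nonneg_of_nonpos hc (hstatic X hX)
  · refine meetsPositiveConeTrivially_of_integral_nonpos hQP hPQ ⟨0, le_rfl, 0,
      ⟨0, 0, Fin.elim0, Fin.elim0, Fin.elim0, hprice0, fun i => i.elim0, fun i => i.elim0,
        fun i => i.elim0, by simp⟩, (zero_smul ℝ _).symm⟩ ?_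
    rintro W ⟨c, hc, X, ⟨X₀, n, τ, Y, Z, hX₀, -, -, hτ, rfl⟩, rfl⟩
    rw [hsmul, hadd]
    refine mul_nonpos_of_nonneg_of_nonpos hc (add_nonpos (hstatic X₀ hX₀) (hsum n _ fun i => ?_))
    have h1 := hle _ _ (le_timeTop (τ i)) (Z i)
    have h2 := hle _ _ (le_timeTop (τ i)) (-Y i)
    have h3 := hmono _ _ (hτ i)
    change _ ≤ ∫ ω, (-essSupPrice P 𝒬 α (τ i) (timeTop F) (-Y i) : LInf P) ω ∂Q at h3
    rw [hneg] at h2 h3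
    rw [sub_eq_add_neg, hadd, hneg]
    have h4 : ∫ ω, Z i ω ∂Q ≤ -∫ ω, essSupPrice P 𝒬 α (τ i) (timeTop F) (-Y i) ω ∂Q :=
      h1.trans h3
    linarith

end IsStablePenalty

end DynamicPricing

theorem mainTheorem6 {Ω : Type*} [mΩ : MeasurableSpace Ω]
    (P : Measure Ω) [IsProbabilityMeasure P] [P.IsComplete]
    (F : Filtration ℝ≥0 mΩ) [F.IsRightContinuous]
    (hF₀ : F 0 = MeasurableSpace.generateFrom {N : Set Ω | MeasurableSet N ∧ P N = 0})
    (𝒬 : Set (Measure Ω))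
    (h𝒬 : ∀ Q ∈ 𝒬, IsProbabilityMeasure Q ∧ Q ≪ P ∧ P ≪ Q)
    (hstable : IsStable F 𝒬)
    (α : Penalty F) (hα : α.IsAdapted 𝒬) (hlocal : α.IsLocal P 𝒬) (hcocycle : α.Cocycle 𝒬)
    (hzero : ∃ Q ∈ 𝒬, ∀ᵐ ω ∂P, α (timeZero F) (timeTop F) Q ω = 0) :
    ∃ Pi : PricingProcedure P F, Pi.IsGivenBy 𝒬 α ∧ Pi.IsTCPP ∧
      Pi.NoStaticFreeLunch ∧ Pi.NoMultiperiodFreeLunch := by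
  have H : IsStablePenalty P F 𝒬 α := ⟨h𝒬, hstable, hα, hlocal, hcocycle, hzero⟩
  exact ⟨H.pricingProcedure, fun σ τ h X _ => (H.essSupPrice_spec h X).2, H.isTCPP, H.noFreeLunch⟩
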